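/- Let $x'=Ax+bu,\ y=cx+du$ be a real, asymptotically stable (all eigenvalues of $A$ have negative real part), minimal (reachable and observable) single-input single-output system of order $n$ with transfer function $G(s)=c(sI-A)^{-1}b+d$. Suppose it is (principal-axis) balanced, i.e. $$A\Sigma+\Sigma A^{\top}+bb^{\top}=0,\qquad A^{\top}\Sigma+\Sigma A+c^{\top}c=0,\qquad \Sigma=\mathrm{diag}(\sigma_1I_{m_1},\dots,\sigma_qI_{m_q}),$$ where $\sigma_1>\dots>\sigma_q>0$ are the distinct Hankel singular values, $m_i\ge 1$ and $m_1+\dots+m_q=n$. Let $S=\mathrm{diag}(s_1,\dots,s_n)$, $s_j\in\{\pm1\}$, be a matrix of sign parameters of the system: there is an invertible $T\in\mathbb R^{n\times n}$ such that $\hat A=T^{-1}AT$, $\hat b=T^{-1}b$, $\hat c=cT$ is again balanced with the same matrix $\Sigma$ and satisfies $\hat A=S\hat A^{\top}S$ and $\hat b=(\hat cS)^{\top}$ (in particular, $T=I$ is allowed if the given realization already has this symmetry). Let $1\le k<q$ and $r=m_1+\dots+m_k$, let $A_{11}$ be the leading $r\times r$ block of $A$ and $b_1,c_1$ the first $r$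 entries of $b,c$, and let $G_r(s)=c_1(sI-A_{11})^{-1}b_1+d$ be the transfer function of the balanced truncation $(A_{11},b_1,c_1,d)$ of order $r$. Partition $S=\mathrm{diag}(S_1,S_2)$ with $S_1$ of size $r\times r$. If $S_2=I_{n-r}$ or $S_2=-I_{n-r}$, then: 1. the truncated Hankel singular values have multiplicity one: $m_{k+1}=\dots=m_q=1$; 2. the balanced truncation is asymptotically stable and attains the balanced truncation error bound, $$\|G-G_r\|_{\mathcal H_\infty}=\sup_{\omega\in\mathbb R}|G(\mathrm i\omega)-G_r(\mathrm i\omega)|=2(\sigma_{k+1}+\dots+\sigma_q),$$ and the supremum is attained at $\omega=0$: $|G(0)-G_r(0)|=2(\sigma_{k+1}+\dots+\sigma_q)$. -/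

import Mathlib

open scoped Matrix ENNReal

/-- The data of a real single-input single-output system
`x' = A x + b u`, `y = c x + d u`, with states indexed by `ι`. -/
structure SISOSystem (ι : Type) where
  A : Matrix ι ι ℝ
  b : ι → ℝ
  c : ι → ℝ
  d : ℝ

namespace SISOSystem

section General

variable {ι : Type} [Fintype ι] [DecidableEq ι]

/-- The transfer function `G(z) = c (z I - A)⁻¹ b + d`. -/
noncomputable def transfer (G : SISOSystem ι) (z : ℂ) : ℂ :=
  (fun i => (G.c i : ℂ)) ⬝ᵥ
    ((z • (1 : Matrix ι ι ℂ) - G.A.map Complex.ofReal)⁻¹ *ᵥ fun i => (G.b i : ℂ)) + (G.d : ℂ)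

/-- All (complex) eigenvalues of `A` have negative real part. -/
def IsAsymptoticallyStable (G : SISOSystem ι) : Prop :=
  ∀ z : ℂ, z ∈ spectrum ℂ (G.A.map Complex.ofReal) → z.re < 0

/-- The vectors `b, A b, A² b, …` span the state space. -/
def IsReachable (G : SISOSystem ι) : Prop :=
  Submodule.span ℝ (Set.range fun j : ℕ => (G.A ^ j) *ᵥ G.b) = ⊤

/-- Only the zero state satisfies `c x = c A x = c A² x = … = 0`. -/
def IsObservable (G : SISOSystem ι) : Prop :=
  ∀ x : ι → ℝ, (∀ j : ℕ, G.c ⬝ᵥ ((G.A ^ j) *ᵥ x) = 0) → x = 0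

def IsMinimal (G : SISOSystem ι) : Prop :=
  G.IsReachable ∧ G.IsObservable

/-- `P` is positive definite and `A P + P Aᵀ + b bᵀ = 0`. -/
def IsReachabilityGramian (G : SISOSystem ι) (P : Matrix ι ι ℝ) : Prop :=
  P.PosDef ∧ G.A * P + P * G.Aᵀ + Matrix.vecMulVec G.b G.b = 0

/-- `Q` is positive definite and `Aᵀ Q + Q A + cᵀ c = 0`. -/
def IsObservabilityGramian (G : SISOSystem ι) (Q : Matrix ι ι ℝ) : Prop :=
  Q.PosDef ∧ G.Aᵀ * Q + Q * G.A + Matrix.vecMulVec G.c G.c = 0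

/-- `G'` is obtained from `G` by an invertible change of state coordinates `x = T x'`, that is
`G' = (T⁻¹ A T, T⁻¹ b, c T, d)`. -/
def IsEquivalent (G G' : SISOSystem ι) : Prop :=
  ∃ T : Matrix ι ι ℝ, IsUnit T ∧
    T * G'.A = G.A * T ∧ T *ᵥ G'.b = G.b ∧ G'.c = G.c ᵥ* T ∧ G'.d = G.d

/-- The sign symmetry `A = S Aᵀ S` and `b = (c S)ᵀ`, where `S = diag(s)`. -/
def IsSignSymmetric (G : SISOSystem ι) (s : ι → ℝ) : Prop :=
  G.A = Matrix.diagonal s * G.Aᵀ * Matrix.diagonal s ∧ G.b = G.c ᵥ* Matrix.diagonal s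

end General

/-- The subsystem of all states satisfying `p`. -/
def restrict {ι : Type} (G : SISOSystem ι) (p : ι → Prop) : SISOSystem {x : ι // p x} where
  A := G.A.submatrix Subtype.val Subtype.val
  b := fun x => G.b x.val
  c := fun x => G.c x.val
  d := G.d

end SISOSystem

/-- The `m 0 + ⋯ + m (q - 1)` states of a system in balanced coordinates: the state `⟨i, j⟩` is the
`j`-th of the `m i` states that belong to the `i`-th distinct Hankel singular value (counted
from `0`). -/
abbrev BalancedIndex {q : ℕ} (m : Fin q → ℕ) : Type := Σ i : Fin q, Fin (m i)

/-- The diagonal matrix `diag(σ 0 • I_{m 0}, …, σ (q - 1) • I_{m (q - 1)})`. -/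
def hankelMatrix {q : ℕ} (m : Fin q → ℕ) (σ : Fin q → ℝ) :
    Matrix (BalancedIndex m) (BalancedIndex m) ℝ :=
  Matrix.diagonal fun x => σ x.1

namespace SISOSystem

variable {q : ℕ} {m : Fin q → ℕ}

/-- `G` is principal-axis balanced, with distinct Hankel singular values
`σ 0 > σ 1 > ⋯ > σ (q - 1) > 0` of multiplicities `m 0, …, m (q - 1)`. -/
def IsBalanced (G : SISOSystem (BalancedIndex m)) (σ : Fin q → ℝ) : Prop :=
  (∀ i, 1 ≤ m i) ∧ StrictAnti σ ∧ (∀ i, 0 < σ i) ∧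
    G.IsReachabilityGramian (hankelMatrix m σ) ∧ G.IsObservabilityGramian (hankelMatrix m σ)

/-- `s` is a family of sign parameters of `G`: some realization equivalent to `G` (possibly `G`
itself) is balanced, with the Hankel singular values in the same decreasing order, and has the sign
symmetry given by `diag(s)`. -/
def HasSignParameters (G : SISOSystem (BalancedIndex m)) (σ : Fin q → ℝ)
    (s : BalancedIndex m → ℝ) : Prop :=
  (∀ x, s x = 1 ∨ s x = -1) ∧
    ∃ G' : SISOSystem (BalancedIndex m),
      G.IsEquivalent G' ∧ G'.IsBalanced σ ∧ G'.IsSignSymmetric s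

/-- Balanced truncation `(A₁₁, b₁, c₁, d)`: keep the states that belong to the `k` largest distinct
Hankel singular values. -/
abbrev balancedTruncation (G : SISOSystem (BalancedIndex m)) (k : ℕ) :
    SISOSystem {x : BalancedIndex m // x.1.val < k} :=
  G.restrict fun x => x.1.val < k

end SISOSystem

/-- The norm `sup_{ω ∈ ℝ} |H(i ω)|`, with values in `[0, ∞]`. -/
noncomputable def hinfNorm (H : ℂ → ℂ) : ℝ≥0∞ :=
  ⨆ ω : ℝ, ‖H (Complex.I * (ω : ℂ))‖ₑ

/-!
# Balanced truncation with equal sign parameters attains the error bound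

The Lyapunov equations of a balanced realization turn into energy identities for complex state
vectors. They carry the two facts that hold for every balanced realization.

* Truncations are stable (`SatisfiesLyapunov.isAsymptoticallyStable_restrict`). An eigenvector of a
  truncated state matrix for an eigenvalue in the closed right half-plane can be chosen inside the
  states of a single singular value, and then it is an eigenvector of the full state matrix.
* Removing the states of one singular value `s` moves the transfer function on the imaginary axis by
  at most `2 s` (`SatisfiesLyapunov.norm_sub_response_le`). This follows from the energies of the
  difference and of the rescaled sum of the two state responses. Telescoping over the removed
  singular values gives the upper bound `2 (σ_{k+1} + ⋯ + σ_q)` (`IsBalanced.norm_transfer_sub_le`).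

The remaining facts come from the sign symmetry `A = S Aᵀ S`, `b = (c S)ᵀ`.

* The matrix `S Σ` is a cross Gramian, so that the steady-state gain is `d + 2 tr (S Σ)`
  (`SatisfiesLyapunov.transfer_zero`). The truncation satisfies the same identity with its own
  block of `S Σ`, hence the error at `0` is `2 tr (S₂ Σ₂)`.
* The Lyapunov equations determine the entries of `A` as
  `A i j = - b i * b j / (σ j + s i * s j * σ i)` wherever the denominator is nonzero. If the removed
  states share one sign, two removed states of the same singular value would belong to parallel
  columns of the invertible matrix `A` (`SatisfiesLyapunov.eq_of_sign_const`). So the removed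
  singular values are simple, and `|2 tr (S₂ Σ₂)|` equals the upper bound.

The sign-symmetric realization may differ from the given one. By uniqueness of the Gramians, the
change of coordinates `T` between them is block diagonal
(`IsAsymptoticallyStable.apply_eq_zero_of_equivalence`), so the truncations have the same transfer
function.
-/

open scoped ComplexConjugate

/-! ### Eigenvectors of real matrices and the Sylvester equation -/

section Spectra

variable {ι : Type} [Fintype ι] [DecidableEq ι]

theorem Matrix.mem_spectrum_iff_exists_eigenvector (M : Matrix ι ι ℂ) (z : ℂ) :
    z ∈ spectrum ℂ M ↔ ∃ v : ι → ℂ, v ≠ 0 ∧ M *ᵥ v = z • v := by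
  rw [spectrum.mem_iff, Matrix.isUnit_iff_isUnit_det, isUnit_iff_ne_zero, not_not,
    ← Matrix.exists_mulVec_eq_zero_iff]
  refine exists_congr fun v => and_congr_right fun _ => ?_
  rw [Matrix.sub_mulVec, Algebra.algebraMap_eq_smul_one, Matrix.smul_mulVec, Matrix.one_mulVec,
    sub_eq_zero, eq_comm]

theorem Matrix.spectrum_transpose_eq (M : Matrix ι ι ℂ) : spectrum ℂ Mᵀ = spectrum ℂ M := by
  ext z
  rw [spectrum.mem_iff, spectrum.mem_iff, Matrix.isUnit_iff_isUnit_det,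
    Matrix.isUnit_iff_isUnit_det, ← Matrix.det_transpose, Matrix.transpose_sub,
    Matrix.transpose_transpose, Algebra.algebraMap_eq_smul_one, Matrix.transpose_smul,
    Matrix.transpose_one]

/-- The homogeneous Sylvester equation `M Y = Y N` has only the zero solution when `M` and `N`
have no common eigenvalue: by Cayley–Hamilton `0 = χ(M) Y = Y χ(N)` for the characteristic
polynomial `χ` of `M`, and `χ(N)` is invertible by the spectral mapping theorem. -/
theorem Matrix.eq_zero_of_mul_eq_mul_of_disjoint_spectrum {M N Y : Matrix ι ι ℂ}
    (h : M * Y = Y * N) (hdisj : Disjoint (spectrum ℂ M) (spectrum ℂ N)) : Y = 0 := by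
  rcases isEmpty_or_nonempty ι with hι | hι
  · exact Subsingleton.elim _ _
  have hpoly : ∀ p : Polynomial ℂ, Polynomial.aeval M p * Y = Y * Polynomial.aeval N p := by
    intro p
    induction p using Polynomial.induction_on with
    | C a => simp [Algebra.algebraMap_eq_smul_one]
    | add p q hp hq => simp [add_mul, mul_add, hp, hq]
    | monomial n a ih =>
      rw [pow_succ, ← mul_assoc, map_mul, map_mul _ _ Polynomial.X, Polynomial.aeval_X,
        Polynomial.aeval_X, mul_assoc, h, ← mul_assoc, ih, mul_assoc]
  have hunit : IsUnit (Polynomial.aeval N M.charpoly) := by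
    rw [← spectrum.zero_notMem_iff ℂ]
    intro h0
    rw [spectrum.map_polynomial_aeval_of_nonempty N M.charpoly
      (spectrum.nonempty_of_isAlgClosed_of_finiteDimensional ℂ N)] at h0
    obtain ⟨z, hz, hz0⟩ := h0
    exact Set.disjoint_left.mp hdisj (Matrix.mem_spectrum_iff_isRoot_charpoly.mpr hz0) hz
  have h1 := hpoly M.charpoly
  rw [Matrix.aeval_self_charpoly, zero_mul] at h1
  exact (hunit.mul_left_eq_zero).mp h1.symm

end Spectra

namespace SISOSystem

section General

variable {ι : Type} [Fintype ι] [DecidableEq ι]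

theorem IsAsymptoticallyStable.lyapunov_eq_zero {G : SISOSystem ι}
    (hG : G.IsAsymptoticallyStable) {X : Matrix ι ι ℝ} (h : G.A * X + X * G.Aᵀ = 0) : X = 0 := by
  have hc : G.A.map Complex.ofReal * X.map Complex.ofReal =
      X.map Complex.ofReal * -(G.A.map Complex.ofReal)ᵀ := by
    have h1 := congrArg (fun M : Matrix ι ι ℝ => M.map Complex.ofRealHom)
      (eq_neg_of_add_eq_zero_left h)
    rw [← mul_neg, Matrix.map_mul, Matrix.map_mul] at h1
    have h2 : (-G.Aᵀ).map Complex.ofRealHom = -(G.A.map Complex.ofReal)ᵀ := by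
      ext i j
      simp
    rw [h2] at h1
    exact h1
  have h0 := Matrix.eq_zero_of_mul_eq_mul_of_disjoint_spectrum hc ?_
  · ext i j
    simpa using congrFun (congrFun h0 i) j
  · refine Set.disjoint_left.mpr fun z hz hz' => ?_
    rw [← spectrum.neg_eq, Set.mem_neg, Matrix.spectrum_transpose_eq] at hz'
    have h1 := hG z hz
    have h2 := hG _ hz'
    simp at h2
    linarith

/-- The dual system `(Aᵀ, cᵀ, bᵀ, d)`. -/
def dual (G : SISOSystem ι) : SISOSystem ι := ⟨G.Aᵀ, G.c, G.b, G.d⟩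

theorem IsAsymptoticallyStable.dual {G : SISOSystem ι} (hG : G.IsAsymptoticallyStable) :
    G.dual.IsAsymptoticallyStable := by
  intro z hz
  refine hG z ?_
  rw [← Matrix.spectrum_transpose_eq]
  exact hz

theorem IsAsymptoticallyStable.notMem_spectrum {G : SISOSystem ι}
    (hG : G.IsAsymptoticallyStable) {z : ℂ} (hz : 0 ≤ z.re) :
    z ∉ spectrum ℂ (G.A.map Complex.ofReal) := fun h => (hG z h).not_ge hz

/-- The transfer function value at `z` in terms of the solution of the state equation
`z X = A X + b`. -/
theorem transfer_eq_of_response (G : SISOSystem ι) {z : ℂ}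
    (hz : z ∉ spectrum ℂ (G.A.map Complex.ofReal)) {X : ι → ℂ}
    (hX : ∀ i, z * X i = (G.A.map Complex.ofReal *ᵥ X) i + G.b i) :
    G.transfer z = (fun i => (G.c i : ℂ)) ⬝ᵥ X + G.d := by
  have hu : IsUnit (z • (1 : Matrix ι ι ℂ) - G.A.map Complex.ofReal) := by
    rw [spectrum.notMem_iff, Algebra.algebraMap_eq_smul_one] at hz
    exact hz
  have hb : (fun i => (G.b i : ℂ)) = (z • (1 : Matrix ι ι ℂ) - G.A.map Complex.ofReal) *ᵥ X := by
    funext i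
    have := hX i
    simp only [Matrix.sub_mulVec, Matrix.smul_mulVec, Matrix.one_mulVec, Pi.sub_apply,
      Pi.smul_apply, smul_eq_mul]
    rw [this]; ring
  rw [transfer, hb, Matrix.mulVec_mulVec,
    Matrix.nonsing_inv_mul _ ((Matrix.isUnit_iff_isUnit_det _).mp hu), Matrix.one_mulVec]

theorem exists_response (G : SISOSystem ι) {z : ℂ}
    (hz : z ∉ spectrum ℂ (G.A.map Complex.ofReal)) :
    ∃ X : ι → ℂ, ∀ i, z * X i = (G.A.map Complex.ofReal *ᵥ X) i + G.b i := by
  have hu : IsUnit (z • (1 : Matrix ι ι ℂ) - G.A.map Complex.ofReal) := by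
    rw [spectrum.notMem_iff, Algebra.algebraMap_eq_smul_one] at hz
    exact hz
  refine ⟨(z • (1 : Matrix ι ι ℂ) - G.A.map Complex.ofReal)⁻¹ *ᵥ fun i => (G.b i : ℂ),
    fun i => ?_⟩
  set X := (z • (1 : Matrix ι ι ℂ) - G.A.map Complex.ofReal)⁻¹ *ᵥ fun i => (G.b i : ℂ) with hX
  have h1 : (z • (1 : Matrix ι ι ℂ) - G.A.map Complex.ofReal) *ᵥ X = fun i => (G.b i : ℂ) := by
    rw [hX, Matrix.mulVec_mulVec,
      Matrix.mul_nonsing_inv _ ((Matrix.isUnit_iff_isUnit_det _).mp hu), Matrix.one_mulVec]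
  have h2 := congrFun h1 i
  simp only [Matrix.sub_mulVec, Matrix.smul_mulVec, Matrix.one_mulVec, Pi.sub_apply,
      Pi.smul_apply, smul_eq_mul] at h2
  rw [← h2]; ring

end General

/-! ### Truncations seen inside the full state space -/

section Truncation

variable {ι : Type} [Fintype ι]

/-- `X` is the state, padded by zeros outside `p`, with which the truncation of `G` to the states
satisfying `p` responds to the input `exp (z t)`: `z X = A X + b` on `p`. -/
def IsTruncatedResponse (G : SISOSystem ι) (p : ι → Prop) (z : ℂ) (X : ι → ℂ) : Prop :=
  (∀ i, ¬ p i → X i = 0) ∧ ∀ i, p i → z * X i = (G.A.map Complex.ofReal *ᵥ X) i + G.b i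

theorem sum_subtype_of_support {p : ι → Prop} [DecidablePred p] {X : ι → ℂ}
    (hX : ∀ i, ¬ p i → X i = 0) (f : ι → ℂ) :
    ∑ i : {i // p i}, f i * X i = ∑ i, f i * X i := by
  rw [← Finset.sum_subtype (Finset.univ.filter p) (by simp) fun i => f i * X i,
    Finset.sum_filter_of_ne]
  intro i _ h
  by_contra hp
  exact h (by rw [hX i hp, mul_zero])

theorem restrict_mulVec {p : ι → Prop} [DecidablePred p] (G : SISOSystem ι) {X : ι → ℂ}
    (hX : ∀ i, ¬ p i → X i = 0) (i : {i // p i}) :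
    ((G.restrict p).A.map Complex.ofReal *ᵥ fun j => X j) i =
      (G.A.map Complex.ofReal *ᵥ X) i := by
  simp only [Matrix.mulVec, dotProduct, restrict, Matrix.map_apply, Matrix.submatrix_apply]
  exact sum_subtype_of_support hX fun j => (G.A i j : ℂ)

theorem IsTruncatedResponse.transfer_restrict [DecidableEq ι] {p : ι → Prop} [DecidablePred p]
    {G : SISOSystem ι} {z : ℂ} {X : ι → ℂ} (hX : G.IsTruncatedResponse p z X)
    (hz : z ∉ spectrum ℂ ((G.restrict p).A.map Complex.ofReal)) :
    (G.restrict p).transfer z = (fun i => (G.c i : ℂ)) ⬝ᵥ X + G.d := by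
  rw [(G.restrict p).transfer_eq_of_response hz (X := fun j => X j)]
  · congr 1
    exact sum_subtype_of_support hX.1 fun i => (G.c i : ℂ)
  · intro i
    rw [restrict_mulVec G hX.1]
    exact hX.2 i i.2

theorem exists_isTruncatedResponse [DecidableEq ι] {p : ι → Prop} [DecidablePred p]
    (G : SISOSystem ι) {z : ℂ}
    (hz : z ∉ spectrum ℂ ((G.restrict p).A.map Complex.ofReal)) :
    ∃ X, G.IsTruncatedResponse p z X := by
  obtain ⟨Y, hY⟩ := (G.restrict p).exists_response hz
  have h0 : ∀ i, ¬ p i → (fun i => if h : p i then Y ⟨i, h⟩ else 0) i = 0 := fun i hi => dif_neg hi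
  refine ⟨fun i => if h : p i then Y ⟨i, h⟩ else 0, h0, fun i hi => ?_⟩
  rw [← restrict_mulVec G h0 ⟨i, hi⟩]
  have hext : (fun j : {i // p i} => if h : p j then Y ⟨j, h⟩ else 0) = Y :=
    funext fun j => dif_pos j.2
  rw [hext]
  simp only [dif_pos hi]
  exact hY ⟨i, hi⟩

theorem transfer_restrict_of_forall [DecidableEq ι] {p : ι → Prop} [DecidablePred p]
    (G : SISOSystem ι) (hp : ∀ i, p i) {z : ℂ}
    (hz : z ∉ spectrum ℂ (G.A.map Complex.ofReal))
    (hz' : z ∉ spectrum ℂ ((G.restrict p).A.map Complex.ofReal)) :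
    (G.restrict p).transfer z = G.transfer z := by
  obtain ⟨X, hX⟩ := G.exists_isTruncatedResponse hz'
  rw [hX.transfer_restrict hz', G.transfer_eq_of_response hz fun i => hX.2 i (hp i)]

end Truncation

/-! ### Energy identities of a balanced realization -/

section Energy

variable {ι : Type}

/-- The Lyapunov equations of the reachability and the observability Gramian, both equal to
`diag(τ)`, written entry by entry. -/
def SatisfiesLyapunov (G : SISOSystem ι) (τ : ι → ℝ) : Prop :=
  (∀ i j, G.A i j * τ j + τ i * G.A j i + G.b i * G.b j = 0) ∧
    ∀ i j, G.A j i * τ j + τ i * G.A i j + G.c i * G.c j = 0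

theorem SatisfiesLyapunov.restrict {G : SISOSystem ι} {τ : ι → ℝ} (h : G.SatisfiesLyapunov τ)
    (p : ι → Prop) : (G.restrict p).SatisfiesLyapunov fun i => τ i :=
  ⟨fun i j => h.1 i j, fun i j => h.2 i j⟩

variable [Fintype ι] {G : SISOSystem ι} {τ : ι → ℝ}

theorem SatisfiesLyapunov.observability_apply (h : G.SatisfiesLyapunov τ) (w : ι → ℂ) (i : ι) :
    τ i * (G.A.map Complex.ofReal *ᵥ w) i + ∑ j, (G.A j i : ℂ) * (τ j * w j) +
      G.c i * ((fun j => (G.c j : ℂ)) ⬝ᵥ w) = 0 := by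
  simp only [Matrix.mulVec, dotProduct, Matrix.map_apply, Finset.mul_sum,
    ← Finset.sum_add_distrib]
  refine Finset.sum_eq_zero fun j _ => ?_
  have := congrArg (fun r : ℝ => (r : ℂ)) (h.2 i j)
  push_cast at this
  linear_combination w j * this

theorem SatisfiesLyapunov.reachability_apply (h : G.SatisfiesLyapunov τ) (w : ι → ℂ) (i : ι) :
    (G.A.map Complex.ofReal *ᵥ fun j => τ j * w j) i + τ i * ∑ j, (G.A j i : ℂ) * w j +
      G.b i * ((fun j => (G.b j : ℂ)) ⬝ᵥ w) = 0 := by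
  simp only [Matrix.mulVec, dotProduct, Matrix.map_apply, Finset.mul_sum,
    ← Finset.sum_add_distrib]
  refine Finset.sum_eq_zero fun j _ => ?_
  have := congrArg (fun r : ℝ => (r : ℂ)) (h.1 i j)
  push_cast at this
  linear_combination w j * this

theorem sum_conj_mul_adjoint (G : SISOSystem ι) (w u : ι → ℂ) :
    ∑ i, conj (w i) * ∑ j, (G.A j i : ℂ) * u j =
      conj (∑ j, conj (u j) * (G.A.map Complex.ofReal *ᵥ w) j) := by
  simp only [Matrix.mulVec, dotProduct, Matrix.map_apply, Finset.mul_sum, map_sum, map_mul,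
    Complex.conj_conj, Complex.conj_ofReal]
  rw [Finset.sum_comm]
  refine Finset.sum_congr rfl fun i _ => Finset.sum_congr rfl fun j _ => by ring

theorem sum_conj_mul_real (a : ι → ℝ) (w : ι → ℂ) :
    ∑ i, conj (w i) * (a i * ((fun j => (a j : ℂ)) ⬝ᵥ w)) =
      ((‖(fun j => (a j : ℂ)) ⬝ᵥ w‖ ^ 2 : ℝ) : ℂ) := by
  rw [Complex.ofReal_pow, ← Complex.conj_mul']
  simp only [← mul_assoc, ← Finset.sum_mul]
  congr 1
  simp only [dotProduct, map_sum, map_mul, Complex.conj_ofReal]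
  exact Finset.sum_congr rfl fun i _ => by ring

theorem SatisfiesLyapunov.observability_energy (h : G.SatisfiesLyapunov τ) (w : ι → ℂ) :
    2 * (∑ i, conj (w i) * (τ i * (G.A.map Complex.ofReal *ᵥ w) i)).re +
      ‖(fun j => (G.c j : ℂ)) ⬝ᵥ w‖ ^ 2 = 0 := by
  have h1 : ∑ i, conj (w i) * (τ i * (G.A.map Complex.ofReal *ᵥ w) i +
      ∑ j, (G.A j i : ℂ) * (τ j * w j) + G.c i * ((fun j => (G.c j : ℂ)) ⬝ᵥ w)) = 0 :=
    Finset.sum_eq_zero fun i _ => by rw [h.observability_apply, mul_zero]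
  simp only [mul_add, Finset.sum_add_distrib] at h1
  rw [sum_conj_mul_real, sum_conj_mul_adjoint] at h1
  have h2 : ∑ j, conj ((τ j : ℂ) * w j) * (G.A.map Complex.ofReal *ᵥ w) j =
      ∑ i, conj (w i) * (τ i * (G.A.map Complex.ofReal *ᵥ w) i) :=
    Finset.sum_congr rfl fun i _ => by rw [map_mul, Complex.conj_ofReal]; ring
  rw [h2] at h1
  have h3 := congrArg Complex.re h1
  simp only [Complex.add_re, Complex.conj_re, Complex.ofReal_re, Complex.zero_re] at h3
  linarith

theorem SatisfiesLyapunov.reachability_energy (h : G.SatisfiesLyapunov τ) (v : ι → ℂ) :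
    2 * (∑ i, conj (v i) * (G.A.map Complex.ofReal *ᵥ fun j => τ j * v j) i).re +
      ‖(fun j => (G.b j : ℂ)) ⬝ᵥ v‖ ^ 2 = 0 := by
  have h1 : ∑ i, conj (v i) * ((G.A.map Complex.ofReal *ᵥ fun j => τ j * v j) i +
      τ i * ∑ j, (G.A j i : ℂ) * v j + G.b i * ((fun j => (G.b j : ℂ)) ⬝ᵥ v)) = 0 :=
    Finset.sum_eq_zero fun i _ => by rw [h.reachability_apply, mul_zero]
  simp only [mul_add, Finset.sum_add_distrib] at h1
  have h2 : ∑ i, conj (v i) * (τ i * ∑ j, (G.A j i : ℂ) * v j) =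
      ∑ i, conj ((τ i : ℂ) * v i) * ∑ j, (G.A j i : ℂ) * v j :=
    Finset.sum_congr rfl fun i _ => by rw [map_mul, Complex.conj_ofReal]; ring
  rw [sum_conj_mul_real, h2, sum_conj_mul_adjoint] at h1
  have h3 := congrArg Complex.re h1
  simp only [Complex.add_re, Complex.conj_re, Complex.ofReal_re, Complex.zero_re] at h3
  linarith

/-! ### The error of removing the states of one singular value -/

/-- Truncating from `p'` to `p`, where all removed states share the singular value `s`, changes the
transfer function on the imaginary axis by at most `2 s`. Let `x` and `z` be the two state
responses, `E` the output error and `ρ = A z + b` on the removed states. The observability energy of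
`x - z` gives `|E|² = 2 s Re ⟨x, ρ⟩`, and the reachability energy of `v = diag(τ)⁻¹ (x + z)` gives
`|bᵀ v - 2|² = 4 - |E|² / s²`. -/
theorem SatisfiesLyapunov.norm_sub_response_le (h : G.SatisfiesLyapunov τ) (hτ : ∀ i, 0 < τ i)
    {p p' : ι → Prop} (hpp : ∀ i, p i → p' i) {s : ℝ} (hs : 0 < s)
    (hτs : ∀ i, p' i → ¬ p i → τ i = s) {ω : ℝ} {x z : ι → ℂ}
    (hx : G.IsTruncatedResponse p' (Complex.I * ω) x)
    (hz : G.IsTruncatedResponse p (Complex.I * ω) z) :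
    ‖(fun i => (G.c i : ℂ)) ⬝ᵥ x - (fun i => (G.c i : ℂ)) ⬝ᵥ z‖ ≤ 2 * s := by
  classical
  -- `ρ` is the residual of `z` in the state equation of the larger truncation
  set ρ : ι → ℂ := fun i => if p i then 0 else (G.A.map Complex.ofReal *ᵥ z) i + G.b i with hρ
  set N : ℂ := ∑ i, conj (x i) * ρ i with hN
  have hzA : ∀ i, p' i → (G.A.map Complex.ofReal *ᵥ z) i = Complex.I * ω * z i + ρ i - G.b i := by
    intro i hi
    by_cases hp : p i
    · simp only [hρ, hp, if_true]; linear_combination -(hz.2 i hp)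
    · simp only [hρ, hp, if_false, hz.1 i hp]; ring
  have hxA : ∀ i, p' i → (G.A.map Complex.ofReal *ᵥ x) i = Complex.I * ω * x i - G.b i := by
    intro i hi
    linear_combination -(hx.2 i hi)
  have hz0 : ∀ i, ¬ p' i → z i = 0 := fun i hi => hz.1 i fun hp => hi (hpp i hp)
  have hreal : ∀ (a : ℝ) (u : ℂ), (conj u * (a * (Complex.I * ω * u))).re = 0 := by
    intro a u
    simp; ring
  -- observability energy of `x - z`
  have hE := h.observability_energy (x - z)
  have hsum1 : (∑ i, conj ((x - z) i) * (τ i * (G.A.map Complex.ofReal *ᵥ (x - z)) i)).re =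
      -(s * N.re) := by
    rw [← Complex.re_ofReal_mul, ← Complex.neg_re, hN, Finset.mul_sum, ← Finset.sum_neg_distrib,
      Complex.re_sum, Complex.re_sum]
    refine Finset.sum_congr rfl fun i _ => ?_
    by_cases hi : p' i
    · have e1 : (G.A.map Complex.ofReal *ᵥ (x - z)) i = Complex.I * ω * (x i - z i) - ρ i := by
        rw [Matrix.mulVec_sub, Pi.sub_apply, hxA i hi, hzA i hi]; ring
      have e2 : conj (x i - z i) * (τ i * ρ i) = s * (conj (x i) * ρ i) := by
        by_cases hp : p i
        · simp [hρ, hp]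
        · rw [hτs i hi hp, hz.1 i hp, sub_zero]; ring
      rw [e1, Pi.sub_apply, mul_sub, mul_sub, Complex.sub_re, hreal, e2]; simp
    · simp [hx.1 i hi, hz0 i hi]
  have hsum2 : (∑ i, conj ((x i + z i) / τ i) * (G.A.map Complex.ofReal *ᵥ (x + z)) i).re =
      N.re / s - 2 * ((fun j => (G.b j : ℂ)) ⬝ᵥ fun i => (x i + z i) / τ i).re := by
    rw [← Complex.div_ofReal_re, hN, dotProduct, Complex.re_sum, Finset.sum_div, Complex.re_sum,
      Complex.re_sum, Finset.mul_sum, ← Finset.sum_sub_distrib]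
    refine Finset.sum_congr rfl fun i _ => ?_
    by_cases hi : p' i
    · have ht : (τ i : ℂ) ≠ 0 := by exact_mod_cast (hτ i).ne'
      have e1 : (G.A.map Complex.ofReal *ᵥ (x + z)) i =
          τ i * (Complex.I * ω * ((x i + z i) / τ i)) + (ρ i - 2 * G.b i) := by
        rw [Matrix.mulVec_add, Pi.add_apply, hxA i hi, hzA i hi]; field_simp; ring
      have e2 : conj ((x i + z i) / τ i) * ρ i = conj (x i) * ρ i / s := by
        by_cases hp : p i
        · simp [hρ, hp]
        · rw [hτs i hi hp, hz.1 i hp, add_zero, map_div₀, Complex.conj_ofReal]; ring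
      have e3 : (conj ((x i + z i) / τ i) * (2 * (G.b i : ℂ))).re =
          2 * ((G.b i : ℂ) * ((x i + z i) / τ i)).re := by
        generalize (x i + z i) / (τ i : ℂ) = u
        simp; ring
      rw [e1, mul_add, Complex.add_re, hreal, mul_sub, Complex.sub_re, e2, e3]; ring
    · simp [hx.1 i hi, hz0 i hi]
  -- reachability energy of `diag(τ)⁻¹ (x + z)`
  have hR := h.reachability_energy fun i => (x i + z i) / τ i
  have hv : (fun j => (τ j : ℂ) * ((x j + z j) / τ j)) = x + z := by
    funext j
    have ht : (τ j : ℂ) ≠ 0 := by exact_mod_cast (hτ j).ne'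
    rw [Pi.add_apply]; field_simp
  rw [hv, hsum2] at hR
  rw [hsum1, dotProduct_sub] at hE
  set E := (fun i => (G.c i : ℂ)) ⬝ᵥ x - (fun i => (G.c i : ℂ)) ⬝ᵥ z
  set β := (fun j => (G.b j : ℂ)) ⬝ᵥ fun i => (x i + z i) / τ i
  have hβ : 4 * β.re ≤ 4 + ‖β‖ ^ 2 := by
    rw [Complex.sq_norm, Complex.normSq_apply]
    nlinarith [sq_nonneg (β.re - 2), sq_nonneg β.im]
  have hN4 : N.re / s ≤ 2 := by linarith
  rw [div_le_iff₀ hs] at hN4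
  refine abs_le_of_sq_le_sq' ?_ (by positivity) |>.2
  nlinarith

end Energy

/-! ### Stability of balanced truncations -/

section Stability

variable {ι : Type} [Fintype ι] [DecidableEq ι] {G : SISOSystem ι} {τ : ι → ℝ}

/-- If `z` with `Re z ≥ 0` is an eigenvalue of the truncated state matrix, with padded eigenvectors
forming the space `V`, the energy identities force `Re z = 0` and make `V` invariant under
`diag(τ)²`. An eigenvector of `diag(τ)²` in `V` only involves states of one singular value,
and as the removed states have other singular values it is an eigenvector of the full `A`. -/
theorem SatisfiesLyapunov.isAsymptoticallyStable_restrict (h : G.SatisfiesLyapunov τ)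
    (hτ : ∀ i, 0 < τ i) (hG : G.IsAsymptoticallyStable) (p : ι → Prop) [DecidablePred p]
    (hsep : ∀ i j, p i → ¬ p j → τ i ≠ τ j) : (G.restrict p).IsAsymptoticallyStable := by
  intro z hz
  by_contra hre
  rw [not_lt] at hre
  let V : Submodule ℂ (ι → ℂ) :=
    { carrier := {v | (∀ i, ¬ p i → v i = 0) ∧
        ∀ i, p i → (G.A.map Complex.ofReal *ᵥ v) i = z * v i}
      add_mem' := fun {u v} hu hv => ⟨fun i hi => by simp [hu.1 i hi, hv.1 i hi], fun i hi => by
        rw [Matrix.mulVec_add, Pi.add_apply, Pi.add_apply, hu.2 i hi, hv.2 i hi, mul_add]⟩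
      zero_mem' := ⟨fun _ _ => rfl, fun i _ => by simp⟩
      smul_mem' := fun a v hv => ⟨fun i hi => by simp [hv.1 i hi], fun i hi => by
        rw [Matrix.mulVec_smul, Pi.smul_apply, Pi.smul_apply, hv.2 i hi]; simp; ring⟩ }
  have hVne : ∃ v ∈ V, v ≠ 0 := by
    obtain ⟨y, hy0, hy⟩ := (Matrix.mem_spectrum_iff_exists_eigenvector _ z).mp hz
    let v : ι → ℂ := fun i => if h : p i then y ⟨i, h⟩ else 0
    have hv0 : ∀ i, ¬ p i → v i = 0 := fun i hi => dif_neg hi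
    have hvy : (fun j : {i // p i} => v j) = y := funext fun j => dif_pos j.2
    refine ⟨v, ⟨hv0, fun i hi => ?_⟩, fun hv => hy0 ?_⟩
    · rw [← restrict_mulVec G hv0 ⟨i, hi⟩, hvy, hy]
      simp [v, hi]
    · rw [← hvy, hv]; rfl
  have hweight : ∀ v : ι → ℂ, (∑ i, conj (v i) * (τ i * (z * v i))).re =
      z.re * ∑ i, τ i * ‖v i‖ ^ 2 := by
    intro v
    rw [Complex.re_sum, Finset.mul_sum]
    refine Finset.sum_congr rfl fun i _ => ?_
    have : conj (v i) * (τ i * (z * v i)) = ((τ i * ‖v i‖ ^ 2 : ℝ) : ℂ) * z := by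
      push_cast; rw [← Complex.conj_mul']; ring
    rw [this, Complex.re_ofReal_mul, mul_comm]
  have henergy : ∀ v ∈ V, (∑ i, conj (v i) * (τ i * (G.A.map Complex.ofReal *ᵥ v) i)).re =
      z.re * ∑ i, τ i * ‖v i‖ ^ 2 := by
    intro v hv
    rw [← hweight]
    congr 1
    refine Finset.sum_congr rfl fun i _ => ?_
    by_cases hi : p i
    · rw [hv.2 i hi]
    · rw [hv.1 i hi]; simp
  have hz0 : z.re = 0 := by
    obtain ⟨v, hv, hv0⟩ := hVne
    have h1 := h.observability_energy v
    rw [henergy v hv] at h1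
    have hpos : 0 < ∑ i, τ i * ‖v i‖ ^ 2 := by
      obtain ⟨i, hi⟩ := Function.ne_iff.mp hv0
      refine Finset.sum_pos' (fun i _ => mul_nonneg (hτ i).le (sq_nonneg _))
        ⟨i, Finset.mem_univ _, mul_pos (hτ i) (pow_pos (norm_pos_iff.mpr hi) 2)⟩
    nlinarith [sq_nonneg ‖(fun j => (G.c j : ℂ)) ⬝ᵥ v‖, mul_nonneg hre hpos.le]
  -- with `Re z = 0` the energy identity leaves no output, so `diag(τ) v` is a left eigenvector
  have hcv : ∀ v ∈ V, (fun j => (G.c j : ℂ)) ⬝ᵥ v = 0 := by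
    intro v hv
    have h1 := h.observability_energy v
    rw [henergy v hv, hz0, zero_mul, mul_zero, zero_add] at h1
    exact norm_eq_zero.mp (pow_eq_zero_iff two_ne_zero |>.mp h1)
  have hadj : ∀ v ∈ V, ∀ i, ∑ j, (G.A j i : ℂ) * (τ j * v j) =
      -(τ i * (G.A.map Complex.ofReal *ᵥ v) i) := by
    intro v hv i
    have h1 := h.observability_apply v i
    rw [hcv v hv, mul_zero, add_zero] at h1
    linear_combination h1
  -- dually, `diag(τ) v` is orthogonal to `b`, so `diag(τ)² v` is a right eigenvector again
  have hbv : ∀ v ∈ V, (fun j => (G.b j : ℂ)) ⬝ᵥ (fun j => (τ j : ℂ) * v j) = 0 := by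
    intro v hv
    have h1 := h.reachability_energy fun j => (τ j : ℂ) * v j
    have h2 : (∑ i, conj ((τ i : ℂ) * v i) *
        (G.A.map Complex.ofReal *ᵥ fun j => (τ j : ℂ) * ((τ j : ℂ) * v j)) i).re = 0 := by
      have h3 := sum_conj_mul_adjoint G (fun j => (τ j : ℂ) * ((τ j : ℂ) * v j))
        fun j => (τ j : ℂ) * v j
      have h4 := congrArg Complex.re h3
      rw [Complex.conj_re] at h4
      rw [← h4, Complex.re_sum]
      refine Finset.sum_eq_zero fun i _ => ?_
      rw [hadj v hv]
      by_cases hi : p i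
      · have : conj ((τ i : ℂ) * (τ i * v i)) * -((τ i : ℂ) * (G.A.map Complex.ofReal *ᵥ v) i) =
            ((-(τ i ^ 3 * ‖v i‖ ^ 2) : ℝ) : ℂ) * z := by
          rw [hv.2 i hi]; push_cast; rw [← Complex.conj_mul']; simp; ring
        rw [this, Complex.re_ofReal_mul, hz0, mul_zero]
      · simp [hv.1 i hi]
    rw [h2, mul_zero, zero_add] at h1
    exact norm_eq_zero.mp (pow_eq_zero_iff two_ne_zero |>.mp h1)
  have hsq : ∀ v ∈ V, ∀ i, (G.A.map Complex.ofReal *ᵥ fun j => (τ j : ℂ) * (τ j * v j)) i =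
      τ i * (τ i * (G.A.map Complex.ofReal *ᵥ v) i) := by
    intro v hv i
    have h1 := h.reachability_apply (fun j => (τ j : ℂ) * v j) i
    rw [hbv v hv, hadj v hv, mul_zero, add_zero] at h1
    linear_combination h1
  let D : Module.End ℂ (ι → ℂ) := Matrix.toLin' (Matrix.diagonal fun i => (τ i : ℂ) * τ i)
  have hD : ∀ v, D v = fun j => (τ j : ℂ) * (τ j * v j) := by
    intro v; funext j
    rw [Matrix.toLin'_apply, Matrix.mulVec_diagonal, mul_assoc]
  have hDV : ∀ v ∈ V, D v ∈ V := by
    intro v hv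
    rw [hD]
    refine ⟨fun i hi => by simp [hv.1 i hi], fun i hi => ?_⟩
    rw [hsq v hv, hv.2 i hi]; ring
  have : Nontrivial V := by
    obtain ⟨v, hv, hv0⟩ := hVne
    exact ⟨⟨⟨v, hv⟩, 0, fun h => hv0 (congrArg Subtype.val h)⟩⟩
  obtain ⟨μ, hμ⟩ := Module.End.exists_eigenvalue (D.restrict hDV)
  obtain ⟨⟨v, hv⟩, hvμ⟩ := hμ.exists_hasEigenvector
  have hv0 : v ≠ 0 := fun h => hvμ.2 (Subtype.ext h)
  have hDv : ∀ i, (τ i : ℂ) * (τ i * v i) = μ * v i := by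
    intro i
    have h1 := congrArg Subtype.val hvμ.apply_eq_smul
    have h2 : D v = μ • v := h1
    rw [hD] at h2
    exact congrFun h2 i
  obtain ⟨i₀, hi₀⟩ := Function.ne_iff.mp hv0
  have hpi₀ : p i₀ := by
    by_contra hp
    exact hi₀ (hv.1 i₀ hp)
  have hμ₀ : μ = (τ i₀ : ℂ) * τ i₀ := by
    have := hDv i₀
    exact (mul_right_cancel₀ hi₀ (by linear_combination this)).symm
  -- off `p`, `hsq` reads `(τ i₀² - τ i²) (A v) i = 0`, and `hsep` excludes `τ i₀ = τ i`
  have hAv : ∀ i, (G.A.map Complex.ofReal *ᵥ v) i = z * v i := by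
    intro i
    by_cases hi : p i
    · exact hv.2 i hi
    · have h1 := hsq v hv i
      have h2 : (fun j => (τ j : ℂ) * (τ j * v j)) = μ • v := funext hDv
      rw [h2, Matrix.mulVec_smul, Pi.smul_apply, smul_eq_mul, hμ₀] at h1
      have h3 : ((τ i₀ : ℂ) * τ i₀ - τ i * τ i) ≠ 0 := by
        intro h0
        have h4 : τ i₀ * τ i₀ = τ i * τ i := by
          exact_mod_cast sub_eq_zero.mp h0
        exact hsep i₀ i hpi₀ hi ((mul_self_inj (hτ i₀).le (hτ i).le).mp h4)
      rw [hv.1 i hi, mul_zero]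
      refine (mul_eq_zero.mp ?_).resolve_left h3
      linear_combination h1
  exact hre.not_gt (hG z ((Matrix.mem_spectrum_iff_exists_eigenvector _ z).mpr
    ⟨v, hv0, funext hAv⟩))

end Stability

/-! ### Consequences of the sign symmetry -/

section SignSymmetry

variable {ι : Type} [Fintype ι] [DecidableEq ι] {G : SISOSystem ι} {τ s : ι → ℝ}

theorem IsSignSymmetric.apply (h : G.IsSignSymmetric s) (i j : ι) :
    G.A i j = s i * G.A j i * s j ∧ G.b i = G.c i * s i := by
  refine ⟨?_, ?_⟩
  · have := congrFun (congrFun h.1 i) j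
    rwa [Matrix.mul_diagonal, Matrix.diagonal_mul, Matrix.transpose_apply] at this
  · have := congrFun h.2 i
    rwa [Matrix.vecMul_diagonal] at this

/-- The steady-state gain of a sign-symmetric balanced system. The matrix `X = diag(s τ)` is a cross
Gramian, `A X + X A + b c = 0`, and the trace of `X + A⁻¹ X A + A⁻¹ b c = 0` is
`2 tr X + c A⁻¹ b = 0`. -/
theorem SatisfiesLyapunov.transfer_zero (h : G.SatisfiesLyapunov τ)
    (hss : ∀ i, s i = 1 ∨ s i = -1) (hA : ∀ i j, G.A i j = s i * G.A j i * s j)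
    (hb : ∀ i, G.b i = G.c i * s i) (hG : G.IsAsymptoticallyStable) :
    G.transfer 0 = ((2 * ∑ i, s i * τ i + G.d : ℝ) : ℂ) := by
  have hs2 : ∀ i, s i * s i = 1 := fun i => by rcases hss i with h | h <;> rw [h] <;> norm_num
  have h0 := IsAsymptoticallyStable.notMem_spectrum hG (z := 0) le_rfl
  have hu : IsUnit (G.A.map Complex.ofReal) := (spectrum.zero_notMem_iff ℂ).mp h0
  set M := G.A.map Complex.ofReal with hM
  let X : Matrix ι ι ℂ := Matrix.diagonal fun i => ((s i * τ i : ℝ) : ℂ)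
  have hcross : M * X + X * M + Matrix.vecMulVec (fun i => (G.b i : ℂ)) (fun i => (G.c i : ℂ)) =
      0 := by
    ext i j
    have h1 := h.1 i j
    have h2 : G.A i j * (s j * τ j) + s i * τ i * G.A i j + G.b i * G.c j = 0 := by
      have e1 : s i * G.A i j = G.A j i * s j := by
        rw [hA i j]; linear_combination G.A j i * s j * hs2 i
      have e2 : G.c j = G.b j * s j := by rw [hb j]; linear_combination -(G.c j) * hs2 j
      linear_combination s j * h1 + τ i * e1 + G.b i * e2
    have h3 : ((G.A i j * (s j * τ j) + s i * τ i * G.A i j + G.b i * G.c j : ℝ) : ℂ) = 0 := by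
      rw [h2, Complex.ofReal_zero]
    simpa [X, M, Matrix.mul_diagonal, Matrix.diagonal_mul, Matrix.vecMulVec_apply] using h3
  rw [transfer, zero_smul, zero_sub]
  have hdet : IsUnit M.det := (Matrix.isUnit_iff_isUnit_det _).mp hu
  have hinv : (-M)⁻¹ = -M⁻¹ := Matrix.inv_eq_left_inv (by
    rw [neg_mul_neg, Matrix.nonsing_inv_mul _ hdet])
  have htr := congrArg (fun N => Matrix.trace (M⁻¹ * N)) hcross
  simp only [mul_add, Matrix.trace_add, mul_zero, Matrix.trace_zero] at htr
  rw [← mul_assoc, Matrix.nonsing_inv_mul _ hdet, one_mul, ← mul_assoc, Matrix.trace_mul_comm _ M,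
    ← mul_assoc, Matrix.mul_nonsing_inv _ hdet, one_mul, Matrix.mul_vecMulVec,
    Matrix.trace_vecMulVec] at htr
  rw [hinv, Matrix.neg_mulVec, dotProduct_neg, dotProduct_comm]
  have htrX : X.trace = ((∑ i, s i * τ i : ℝ) : ℂ) := by
    simp [X, Matrix.trace_diagonal]
  rw [htrX] at htr
  push_cast at htr ⊢
  linear_combination -htr

/-- A sign-symmetric balanced `A` has parallel columns for two states of the same singular value
whose sign is shared by all states of no larger singular value, so `A` is singular. -/
theorem SatisfiesLyapunov.eq_of_sign_const (h : G.SatisfiesLyapunov τ) (hτ : ∀ i, 0 < τ i)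
    (hss : ∀ i, s i = 1 ∨ s i = -1) (hA : ∀ i j, G.A i j = s i * G.A j i * s j)
    (hG : G.IsAsymptoticallyStable) {x y : ι} (hxy : τ x = τ y) (hsxy : s x = s y)
    (hsame : ∀ i, τ i ≤ τ x → s i = s x) : x = y := by
  by_contra hne
  have hs2 : ∀ i, s i * s i = 1 := fun i => by rcases hss i with h | h <;> rw [h] <;> norm_num
  have hcol : ∀ i u, G.A i u * (τ u + τ i * (s i * s u)) = -(G.b i * G.b u) := by
    intro i u
    have h1 := h.1 i u
    rw [hA u i] at h1
    linear_combination h1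
  have hne0 : ∀ i, τ x + τ i * (s i * s x) ≠ 0 := by
    intro i h0
    have hi := hτ i
    have hx := hτ x
    by_cases hle : τ i ≤ τ x
    · rw [hsame i hle, hs2] at h0; linarith
    · have h1 : s i * s x = 1 ∨ s i * s x = -1 := by
        rcases hss i with h | h <;> rcases hss x with h' | h' <;> rw [h, h'] <;> norm_num
      rcases h1 with h1 | h1 <;> rw [h1] at h0 <;> linarith
  have hprop : ∀ i, G.A i x * G.b y = G.A i y * G.b x := by
    intro i
    have h1 := hcol i x
    have h2 := hcol i y
    rw [← hxy, ← hsxy] at h2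
    refine mul_right_cancel₀ (hne0 i) ?_
    linear_combination G.b y * h1 - G.b x * h2
  have hker : ∀ v : ι → ℝ, G.A *ᵥ v = 0 → v = 0 := by
    intro v hv
    have h0 := IsAsymptoticallyStable.notMem_spectrum hG (z := 0) le_rfl
    rw [Matrix.mem_spectrum_iff_exists_eigenvector] at h0
    by_contra hv0
    refine h0 ⟨fun i => (v i : ℂ), fun h => hv0 (funext fun i => ?_), ?_⟩
    · simpa using congrFun h i
    · funext i
      have := congrArg (fun r : ℝ => (r : ℂ)) (congrFun hv i)
      simpa [Matrix.mulVec, dotProduct] using this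
  by_cases hbx : G.b x = 0
  · have h1 : Pi.single x (1 : ℝ) = (0 : ι → ℝ) := by
      refine hker _ (funext fun i => ?_)
      have h2 := hcol i x
      rw [hbx, mul_zero, neg_zero] at h2
      simpa using (mul_eq_zero.mp h2).resolve_right (hne0 i)
    simpa using congrFun h1 x
  · have h1 : Pi.single x (G.b y) - Pi.single y (G.b x) = (0 : ι → ℝ) := by
      refine hker _ (funext fun i => ?_)
      have h2 := hprop i
      simp only [Matrix.mulVec_sub, Pi.sub_apply, Matrix.mulVec_single, Pi.smul_apply,
        Matrix.col_apply, Pi.zero_apply, MulOpposite.smul_eq_mul_unop, MulOpposite.unop_op]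
      linarith
    have h2 := congrFun h1 y
    simp [Ne.symm hne] at h2
    exact hbx h2

end SignSymmetry

/-! ### Equivalent balanced realizations -/

section Equivalence

variable {ι : Type} [Fintype ι] {G G' : SISOSystem ι} {T : Matrix ι ι ℝ}

theorem map_mulVec_map_of_mul_eq (hA : T * G'.A = G.A * T) (v : ι → ℂ) :
    G.A.map Complex.ofReal *ᵥ (T.map Complex.ofReal *ᵥ v) =
      T.map Complex.ofReal *ᵥ (G'.A.map Complex.ofReal *ᵥ v) := by
  have h1 := congrArg (fun M : Matrix ι ι ℝ => M.map Complex.ofRealHom) hA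
  rw [Matrix.map_mul, Matrix.map_mul] at h1
  rw [Matrix.mulVec_mulVec, Matrix.mulVec_mulVec]
  exact congrArg (· *ᵥ v) h1.symm

/-- A change of coordinates that does not mix the states in `p` with the others also relates the
responses of the truncations. -/
theorem IsTruncatedResponse.mulVec_map (hA : T * G'.A = G.A * T)
    (hb : T *ᵥ G'.b = G.b)
    {p : ι → Prop} (hTp : ∀ i j, p i → ¬ p j → T i j = 0)
    (hTp' : ∀ i j, ¬ p i → p j → T i j = 0) {z : ℂ} {X : ι → ℂ}
    (hX : G'.IsTruncatedResponse p z X) :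
    G.IsTruncatedResponse p z (T.map Complex.ofReal *ᵥ X) := by
  refine ⟨fun i hi => Finset.sum_eq_zero fun j _ => ?_, fun i hi => ?_⟩
  · by_cases hj : p j
    · simp [hTp' i j hi hj]
    · simp [hX.1 j hj]
  · rw [map_mulVec_map_of_mul_eq hA, ← congrFun hb i]
    simp only [Matrix.mulVec, dotProduct, Matrix.map_apply, Complex.ofReal_sum, Complex.ofReal_mul]
    rw [Finset.mul_sum, ← Finset.sum_add_distrib]
    refine Finset.sum_congr rfl fun j _ => ?_
    by_cases hj : p j
    · have := hX.2 j hj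
      simp only [Matrix.mulVec, dotProduct, Matrix.map_apply] at this
      linear_combination (T i j : ℂ) * this
    · simp [hTp i j hi hj]

variable [DecidableEq ι]

theorem IsAsymptoticallyStable.of_mul_eq (hG : G.IsAsymptoticallyStable) (hT : IsUnit T)
    (hA : T * G'.A = G.A * T) : G'.IsAsymptoticallyStable := by
  intro z hz
  obtain ⟨v, hv0, hv⟩ := (Matrix.mem_spectrum_iff_exists_eigenvector _ z).mp hz
  refine hG z ((Matrix.mem_spectrum_iff_exists_eigenvector _ z).mpr
    ⟨T.map Complex.ofReal *ᵥ v, fun h0 => hv0 ?_, ?_⟩)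
  · have hTc : IsUnit (T.map Complex.ofReal) := hT.map (Complex.ofRealHom.mapMatrix (m := ι))
    exact Matrix.mulVec_injective_iff_isUnit.mpr hTc (h0.trans (Matrix.mulVec_zero _).symm)
  · rw [map_mulVec_map_of_mul_eq hA, hv, Matrix.mulVec_smul]

theorem IsAsymptoticallyStable.lyapunov_unique (hG : G.IsAsymptoticallyStable)
    {P Q B : Matrix ι ι ℝ} (hP : G.A * P + P * G.Aᵀ + B = 0) (hQ : G.A * Q + Q * G.Aᵀ + B = 0) :
    P = Q := by
  refine sub_eq_zero.mp (hG.lyapunov_eq_zero ?_)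
  rw [mul_sub, sub_mul, ← sub_eq_zero.mpr (hP.trans hQ.symm)]
  abel

/-- A change of coordinates between two stable realizations that are balanced with the same
Gramian `D = diag(τ)` satisfies `T D Tᵀ = D` and `Tᵀ D T = D`. Hence it commutes with `D²` and does
not mix states with different singular values. -/
theorem IsAsymptoticallyStable.apply_eq_zero_of_equivalence (hG : G.IsAsymptoticallyStable)
    (hT : IsUnit T) (hA : T * G'.A = G.A * T) (hb : T *ᵥ G'.b = G.b) (hc : G'.c = G.c ᵥ* T)
    {τ : ι → ℝ} (hτ : ∀ i, 0 < τ i)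
    (hR : G.IsReachabilityGramian (Matrix.diagonal τ))
    (hO : G.IsObservabilityGramian (Matrix.diagonal τ))
    (hR' : G'.IsReachabilityGramian (Matrix.diagonal τ))
    (hO' : G'.IsObservabilityGramian (Matrix.diagonal τ)) {i j : ι} (hij : τ i ≠ τ j) :
    T i j = 0 := by
  set D := Matrix.diagonal τ with hD
  have hAt : G'.Aᵀ * Tᵀ = Tᵀ * G.Aᵀ := by
    rw [← Matrix.transpose_mul, hA, Matrix.transpose_mul]
  have h1 : T * D * Tᵀ = D := by
    refine hG.lyapunov_unique (B := Matrix.vecMulVec G.b G.b) ?_ hR.2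
    have h2 : T * (G'.A * D + D * G'.Aᵀ + Matrix.vecMulVec G'.b G'.b) * Tᵀ = 0 := by
      rw [hR'.2, mul_zero, zero_mul]
    have h3 : T * Matrix.vecMulVec G'.b G'.b * Tᵀ = Matrix.vecMulVec G.b G.b := by
      rw [Matrix.mul_vecMulVec, Matrix.vecMulVec_mul, Matrix.vecMul_transpose, hb]
    rw [mul_add, mul_add, add_mul, add_mul, h3, ← mul_assoc, hA] at h2
    rw [← h2]
    simp only [mul_assoc, hAt]
  have h1' : Tᵀ * D * T = D := by
    have hG' := (hG.of_mul_eq hT hA).dual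
    refine hG'.lyapunov_unique (B := Matrix.vecMulVec G'.c G'.c) ?_ ?_
    · change G'.Aᵀ * (Tᵀ * D * T) + Tᵀ * D * T * G'.Aᵀᵀ + Matrix.vecMulVec G'.c G'.c = 0
      rw [Matrix.transpose_transpose]
      have h2 : Tᵀ * (G.Aᵀ * D + D * G.A + Matrix.vecMulVec G.c G.c) * T = 0 := by
        rw [hO.2, mul_zero, zero_mul]
      have h3 : Tᵀ * Matrix.vecMulVec G.c G.c * T = Matrix.vecMulVec G'.c G'.c := by
        rw [Matrix.mul_vecMulVec, Matrix.vecMulVec_mul, Matrix.mulVec_transpose, hc]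
      rw [mul_add, mul_add, add_mul, add_mul, h3, ← mul_assoc, ← hAt] at h2
      rw [← h2]
      simp only [mul_assoc, hA]
    · change G'.Aᵀ * D + D * G'.Aᵀᵀ + Matrix.vecMulVec G'.c G'.c = 0
      rw [Matrix.transpose_transpose]
      exact hO'.2
  have hcomm : T * D * D = D * D * T := by
    calc T * D * D = T * D * (Tᵀ * D * T) := by rw [h1']
      _ = T * D * Tᵀ * D * T := by simp only [mul_assoc]
      _ = D * D * T := by rw [h1]
  have hent := congrFun (congrFun hcomm i) j
  rw [hD, Matrix.mul_diagonal, Matrix.mul_diagonal, mul_assoc, Matrix.diagonal_mul_diagonal,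
    Matrix.diagonal_mul] at hent
  have hne : τ j * τ j - τ i * τ i ≠ 0 := by
    intro h0
    exact hij ((mul_self_inj (hτ i).le (hτ j).le).mp (sub_eq_zero.mp h0).symm)
  refine (mul_eq_zero.mp ?_).resolve_right hne
  linear_combination hent

theorem transfer_restrict_eq_of_equivalence (hA : T * G'.A = G.A * T) (hb : T *ᵥ G'.b = G.b)
    (hc : G'.c = G.c ᵥ* T) (hd : G'.d = G.d) {p : ι → Prop} [DecidablePred p]
    (hTp : ∀ i j, p i → ¬ p j → T i j = 0) (hTp' : ∀ i j, ¬ p i → p j → T i j = 0) {z : ℂ}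
    (hz : z ∉ spectrum ℂ ((G.restrict p).A.map Complex.ofReal))
    (hz' : z ∉ spectrum ℂ ((G'.restrict p).A.map Complex.ofReal)) :
    (G'.restrict p).transfer z = (G.restrict p).transfer z := by
  obtain ⟨X, hX⟩ := G'.exists_isTruncatedResponse hz'
  rw [hX.transfer_restrict hz', (hX.mulVec_map hA hb hTp hTp').transfer_restrict hz, hd,
    Matrix.dotProduct_mulVec]
  congr 2
  funext j
  have := congrFun hc j
  simp [this, Matrix.vecMul, dotProduct]

end Equivalence

/-! ### Balanced truncations -/

section BalancedTruncation

variable {q : ℕ} {m : Fin q → ℕ} {σ : Fin q → ℝ} {G : SISOSystem (BalancedIndex m)}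

theorem IsBalanced.satisfiesLyapunov (h : G.IsBalanced σ) :
    G.SatisfiesLyapunov fun x => σ x.1 := by
  constructor <;> intro i j
  · have := congrFun (congrFun h.2.2.2.1.2 i) j
    simpa [hankelMatrix, Matrix.mul_diagonal, Matrix.diagonal_mul, Matrix.vecMulVec_apply]
      using this
  · have := congrFun (congrFun h.2.2.2.2.2 i) j
    simpa [hankelMatrix, Matrix.mul_diagonal, Matrix.diagonal_mul, Matrix.vecMulVec_apply]
      using this

theorem IsBalanced.isAsymptoticallyStable_balancedTruncation (h : G.IsBalanced σ)
    (hG : G.IsAsymptoticallyStable) (j : ℕ) : (G.balancedTruncation j).IsAsymptoticallyStable :=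
  h.satisfiesLyapunov.isAsymptoticallyStable_restrict (fun x => h.2.2.1 x.1) hG _
    fun _ _ hx hy hxy => hy (h.2.1.injective hxy ▸ hx)

theorem IsBalanced.norm_transfer_succ_sub_le (h : G.IsBalanced σ)
    (hG : G.IsAsymptoticallyStable) {j : ℕ} (hj : j < q) (ω : ℝ) :
    ‖(G.balancedTruncation (j + 1)).transfer (Complex.I * ω) -
      (G.balancedTruncation j).transfer (Complex.I * ω)‖ ≤ 2 * σ ⟨j, hj⟩ := by
  have hre : 0 ≤ (Complex.I * (ω : ℂ)).re := by simp
  have h1 := IsAsymptoticallyStable.notMem_spectrum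
    (h.isAsymptoticallyStable_balancedTruncation hG (j + 1)) hre
  have h0 := IsAsymptoticallyStable.notMem_spectrum
    (h.isAsymptoticallyStable_balancedTruncation hG j) hre
  obtain ⟨x, hx⟩ := G.exists_isTruncatedResponse h1
  obtain ⟨z, hz⟩ := G.exists_isTruncatedResponse h0
  rw [hx.transfer_restrict h1, hz.transfer_restrict h0, add_sub_add_right_eq_sub]
  refine h.satisfiesLyapunov.norm_sub_response_le (fun x => h.2.2.1 x.1)
    (fun x hx => hx.trans (Nat.lt_succ_self j)) (h.2.2.1 _) (fun x hx hx' => ?_) hx hz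
  exact congrArg σ (Fin.ext (by simp only; omega))

theorem IsBalanced.norm_transfer_balancedTruncation_sub_le (h : G.IsBalanced σ)
    (hG : G.IsAsymptoticallyStable) {k j : ℕ} (hkj : k ≤ j) (hj : j ≤ q) (ω : ℝ) :
    ‖(G.balancedTruncation j).transfer (Complex.I * ω) -
      (G.balancedTruncation k).transfer (Complex.I * ω)‖ ≤
        2 * ∑ i : Fin q with k ≤ i.val ∧ i.val < j, σ i := by
  induction j, hkj using Nat.le_induction with
  | base =>
    rw [sub_self, norm_zero]
    exact mul_nonneg zero_le_two (Finset.sum_nonneg fun i _ => (h.2.2.1 i).le)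
  | succ j hkj ih =>
    have hfilter : (Finset.univ.filter fun i : Fin q => k ≤ i.val ∧ i.val < j + 1) =
        insert ⟨j, hj⟩ (Finset.univ.filter fun i : Fin q => k ≤ i.val ∧ i.val < j) := by
      ext i
      simp only [Finset.mem_filter, Finset.mem_univ, true_and, Finset.mem_insert, Fin.ext_iff]
      omega
    rw [hfilter, Finset.sum_insert (by simp), mul_add]
    refine (norm_sub_le_norm_sub_add_norm_sub _
      ((G.balancedTruncation j).transfer (Complex.I * ω)) _).trans ?_
    exact add_le_add (h.norm_transfer_succ_sub_le hG hj ω) (ih (by omega))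

/-- The full system is its own truncation to all `q` singular values. -/
theorem IsBalanced.transfer_balancedTruncation_full (h : G.IsBalanced σ)
    (hG : G.IsAsymptoticallyStable) {z : ℂ} (hz : 0 ≤ z.re) :
    (G.balancedTruncation q).transfer z = G.transfer z :=
  G.transfer_restrict_of_forall (fun x => x.1.isLt) (IsAsymptoticallyStable.notMem_spectrum hG hz)
    (IsAsymptoticallyStable.notMem_spectrum (h.isAsymptoticallyStable_balancedTruncation hG q) hz)

theorem IsBalanced.norm_transfer_sub_le (h : G.IsBalanced σ) (hG : G.IsAsymptoticallyStable)
    {k : ℕ} (hk : k ≤ q) (ω : ℝ) :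
    ‖G.transfer (Complex.I * ω) - (G.balancedTruncation k).transfer (Complex.I * ω)‖ ≤
      2 * ∑ i : Fin q with k ≤ i.val, σ i := by
  rw [← h.transfer_balancedTruncation_full hG (by simp)]
  simpa using h.norm_transfer_balancedTruncation_sub_le hG hk le_rfl ω

theorem IsBalanced.transfer_zero_balancedTruncation (h : G.IsBalanced σ)
    (hG : G.IsAsymptoticallyStable) {s : BalancedIndex m → ℝ} (hss : ∀ x, s x = 1 ∨ s x = -1)
    (hsym : G.IsSignSymmetric s) (j : ℕ) :
    (G.balancedTruncation j).transfer 0 =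
      ((2 * ∑ x : BalancedIndex m with x.1.val < j, s x * σ x.1 + G.d : ℝ) : ℂ) := by
  have hgain := SatisfiesLyapunov.transfer_zero (G := G.balancedTruncation j)
    (s := fun x => s x) (h.satisfiesLyapunov.restrict _) (fun x => hss x)
    (fun x y => (hsym.apply x y).1) (fun x => (hsym.apply x x).2)
    (h.isAsymptoticallyStable_balancedTruncation hG j)
  rw [hgain, Finset.sum_subtype (p := fun x : BalancedIndex m => x.1.val < j) _ (by simp)]
  rfl

/-- The change of coordinates between two balanced realizations is block diagonal, so its leading
block relates their truncations. -/
theorem IsEquivalent.transfer_balancedTruncation_eq {G' : SISOSystem (BalancedIndex m)}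
    (hequiv : G.IsEquivalent G') (h : G.IsBalanced σ) (h' : G'.IsBalanced σ)
    (hG : G.IsAsymptoticallyStable) (j : ℕ) {z : ℂ} (hz : 0 ≤ z.re) :
    (G'.balancedTruncation j).transfer z = (G.balancedTruncation j).transfer z := by
  obtain ⟨T, hT, hA, hb, hc, hd⟩ := hequiv
  have hT0 : ∀ x y : BalancedIndex m, x.1 ≠ y.1 → T x y = 0 := fun x y hxy =>
    hG.apply_eq_zero_of_equivalence hT hA hb hc (fun x => h.2.2.1 x.1) h.2.2.2.1 h.2.2.2.2
      h'.2.2.2.1 h'.2.2.2.2 fun hσ => hxy (h.2.1.injective hσ)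
  exact transfer_restrict_eq_of_equivalence hA hb hc hd
    (fun x y hx hy => hT0 x y fun hxy => hy (hxy ▸ hx))
    (fun x y hx hy => hT0 x y fun hxy => hx (hxy ▸ hy))
    (IsAsymptoticallyStable.notMem_spectrum (h.isAsymptoticallyStable_balancedTruncation hG j) hz)
    (IsAsymptoticallyStable.notMem_spectrum
      (h'.isAsymptoticallyStable_balancedTruncation (hG.of_mul_eq hT hA) j) hz)

end BalancedTruncation

end SISOSystem

theorem theorem3p1 {q : ℕ} (m : Fin q → ℕ) (σ : Fin q → ℝ)
    (k : ℕ) (hk_pos : 1 ≤ k) (hk_lt : k < q)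
    (G : SISOSystem (BalancedIndex m))
    (hstable : G.IsAsymptoticallyStable) (hminimal : G.IsMinimal) (hbalanced : G.IsBalanced σ)
    (s : BalancedIndex m → ℝ) (hs : G.HasSignParameters σ s)
    (hsame : (∀ x : BalancedIndex m, k ≤ x.1.val → s x = 1) ∨
      (∀ x : BalancedIndex m, k ≤ x.1.val → s x = -1)) :
    (∀ i : Fin q, k ≤ i.val → m i = 1) ∧
    (G.balancedTruncation k).IsAsymptoticallyStable ∧
    hinfNorm (fun z => G.transfer z - (G.balancedTruncation k).transfer z) =
      ENNReal.ofReal (2 * ∑ i : Fin q with k ≤ i.val, σ i) ∧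
    ‖G.transfer 0 - (G.balancedTruncation k).transfer 0‖ =
      2 * ∑ i : Fin q with k ≤ i.val, σ i := by
  obtain ⟨hss, G', hequiv, hbal', hsym⟩ := hs
  have hG' : G'.IsAsymptoticallyStable := by
    obtain ⟨T, hT, hA, -⟩ := hequiv
    exact hstable.of_mul_eq hT hA
  obtain ⟨ε, hε, hsε⟩ : ∃ ε : ℝ, |ε| = 1 ∧ ∀ x : BalancedIndex m, k ≤ x.1.val → s x = ε := by
    rcases hsame with h | h
    · exact ⟨1, by simp, h⟩
    · exact ⟨-1, by simp, h⟩
  have hm : ∀ i : Fin q, k ≤ i.val → m i = 1 := by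
    intro i hi
    refine le_antisymm (not_lt.mp fun h2 => ?_) (hbalanced.1 i)
    have heq := hbal'.satisfiesLyapunov.eq_of_sign_const (fun x => hbal'.2.2.1 x.1) hss
      (fun x y => (hsym.apply x y).1) hG' (x := ⟨i, ⟨0, by omega⟩⟩) (y := ⟨i, ⟨1, h2⟩⟩) rfl
      ((hsε _ hi).trans (hsε _ hi).symm) fun x hx => ?_
    · simp at heq
    · have hle : i ≤ x.1 := (hbal'.2.1.le_iff_ge).mp hx
      exact (hsε x (hi.trans hle)).trans (hsε _ hi).symm
  have hzero : ‖G.transfer 0 - (G.balancedTruncation k).transfer 0‖ =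
      2 * ∑ i : Fin q with k ≤ i.val, σ i := by
    have hsum : ∑ x : BalancedIndex m with x.1.val < q, s x * σ x.1 -
        ∑ x : BalancedIndex m with x.1.val < k, s x * σ x.1 =
          ε * ∑ i : Fin q with k ≤ i.val, σ i := by
      rw [Finset.sum_filter, Finset.sum_filter, Finset.sum_filter, ← Finset.sum_sub_distrib,
        Fintype.sum_sigma, Finset.mul_sum]
      refine Finset.sum_congr rfl fun i _ => ?_
      by_cases hi : k ≤ i.val
      · rw [if_pos hi, Finset.sum_congr rfl (g := fun _ => ε * σ i) fun j _ => ?_]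
        · simp [hm i hi]
        · simp [not_lt.mpr hi, hsε ⟨i, j⟩ hi]
      · simp [hi, not_le.mp hi]
    rw [← hbalanced.transfer_balancedTruncation_full hstable le_rfl,
      ← hequiv.transfer_balancedTruncation_eq hbalanced hbal' hstable q le_rfl,
      ← hequiv.transfer_balancedTruncation_eq hbalanced hbal' hstable k le_rfl,
      hbal'.transfer_zero_balancedTruncation hG' hss hsym,
      hbal'.transfer_zero_balancedTruncation hG' hss hsym, ← Complex.ofReal_sub,
      Complex.norm_real, add_sub_add_right_eq_sub, ← mul_sub, hsum, Real.norm_eq_abs, abs_mul,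
      abs_mul, hε, one_mul, abs_two,
      abs_of_nonneg (Finset.sum_nonneg fun i _ => (hbalanced.2.2.1 i).le)]
  refine ⟨hm, hbalanced.isAsymptoticallyStable_balancedTruncation hstable k, ?_, hzero⟩
  refine le_antisymm (iSup_le fun ω => ?_) ?_
  · rw [← ofReal_norm]
    exact ENNReal.ofReal_le_ofReal (hbalanced.norm_transfer_sub_le hstable hk_lt.le ω)
  · refine le_iSup_of_le 0 ?_
    rw [Complex.ofReal_zero, mul_zero, ← ofReal_norm, hzero]
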